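/- **Definitions.** For a bounded operator $A$ on a complex Hilbert space $H$, let $\{A\}'=\{B\in\mathcal L(H):AB=BA\}$. An idempotent is an operator $P$ with $P^2=P$; a projection is a self-adjoint idempotent. $A$ is *irreducible* if $\{A\}'$ contains no projections other than $0$ and $I$, and *strongly irreducible* if $XAX^{-1}$ is irreducible for every invertible $X\in\mathcal L(H)$. A *bounded maximal abelian set of idempotents in $\{A\}'$* is a norm-bounded set of pairwise commuting idempotents in $\{A\}'$ that is maximal, with respect to inclusion, among all sets of pairwise commuting idempotents in $\{A\}'$. A *strongly irreducible decomposition* (S.I.D.) of $A$ is a representation of $A$ as a direct integral whose integrand is strongly irreducible almost everywhere. The S.I.D. of $A$ is *unique up to similarity* if for any two bounded maximal abelian sets of idempotents $\mathscr P,\mathscr Q$ in $\{A\}'$ there is an invertible operator $X\in\{A\}'$ with $X\mathscr PX^{-1}=\mathscr Q$. **Lemma.** Let $\Lambda$ be a standard Borel space (for example a bounded Borel subset of the plane), $\mu$ a $\sigma$-finite Borel measure on $\Lambda$, $n\ge 1$ an integer, and $\phi,\phi_{ij}\in L^\infty(\mu)$ for $1\le i<j\le n$. Write $M_f$ for multiplication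 by $f\in L^\infty(\mu)$ on $L^2(\mu)$, and let $T$ be the operator on $L^2(\mu)^{(n)}$, the Hilbert space direct sum of $n$ copies of $L^2(\mu)$, given by $$T=\begin{pmatrix} M_{\phi}&M_{\phi_{12}}&M_{\phi_{13}}&\cdots&M_{\phi_{1n}}\\ 0&M_{\phi}&M_{\phi_{23}}&\cdots&M_{\phi_{2n}}\\ 0&0&M_{\phi}&\cdots&M_{\phi_{3n}}\\ \vdots&\vdots&\vdots&\ddots&\vdots\\ 0&0&0&\cdots&M_{\phi} \end{pmatrix}.$$ Assume that $\phi_{i,i+1}\neq 0$ almost everywhere for $i=1,\dots,n-1$ and that $\phi$ is injective almost everywhere, that is, injective on the complement of some $\mu$-null set. Then: 1. $T$ is the direct integral over $(\Lambda,\mu)$ of the $n\times n$ matrices $T(\lambda)$ with diagonal entries $\phi(\lambda)$, entries $\phi_{ij}(\lambda)$ for $i<j$ and zeros below the diagonal, and this is a strongly irreducible decomposition of $T$. 2. Every $X\in\{T\}'$ has the form $$X=\begin{pmatrix} M_{\psi}&M_{\psi_{12}}&M_{\psi_{13}}&\cdots&M_{\psi_{1n}}\\ 0&M_{\psi}&M_{\psi_{23}}&\cdots&M_{\psi_{2n}}\\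 0&0&M_{\psi}&\cdots&M_{\psi_{3n}}\\ \vdots&\vdots&\vdots&\ddots&\vdots\\ 0&0&0&\cdots&M_{\psi} \end{pmatrix}$$ with $\psi,\psi_{ij}\in L^\infty(\mu)$. 3. The set of all projections in $\{T\}'$ is a bounded maximal abelian set of idempotents in $\{T\}'$, and it is the only one. 4. The S.I.D. of $T$ is unique up to similarity. -/

import Mathlib

open MeasureTheory
open scoped ENNReal

namespace JordanSID

section Abstract

variable {H : Type*} [NormedAddCommGroup H] [InnerProductSpace ℂ H] [CompleteSpace H]

/-- The commutant `{A}'` of a bounded operator `A`. -/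
def commutant (A : H →L[ℂ] H) : Set (H →L[ℂ] H) :=
  Set.centralizer {A}

/-- `A` is irreducible: `{A}'` contains no (orthogonal) projections other than `0` and `I`. -/
def IsIrreducibleOp (A : H →L[ℂ] H) : Prop :=
  ∀ P ∈ commutant A, IsStarProjection P → P = 0 ∨ P = 1

/-- `A` is strongly irreducible: `X A X⁻¹` is irreducible for every invertible bounded `X`. -/
def IsStronglyIrreducibleOp (A : H →L[ℂ] H) : Prop :=
  ∀ X : (H →L[ℂ] H)ˣ,
    IsIrreducibleOp ((X : H →L[ℂ] H) * A * ((X⁻¹ : (H →L[ℂ] H)ˣ) : H →L[ℂ] H))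

/-- `S` is an abelian set of idempotents in `{A}'`. -/
def IsAbelianIdempotentSet (A : H →L[ℂ] H) (S : Set (H →L[ℂ] H)) : Prop :=
  S ⊆ commutant A ∧ (∀ P ∈ S, IsIdempotentElem P) ∧ ∀ P ∈ S, ∀ Q ∈ S, Commute P Q

/-- `S` is a bounded maximal abelian set of idempotents in `{A}'`: it is maximal (for inclusion)
among all abelian sets of idempotents in `{A}'`, and it is bounded in operator norm. -/
def IsBoundedMaximalAbelianIdempotentSet (A : H →L[ℂ] H) (S : Set (H →L[ℂ] H)) : Prop :=
  Maximal (IsAbelianIdempotentSet A) S ∧ ∃ C : ℝ, ∀ P ∈ S, ‖P‖ ≤ C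

/-- The strongly irreducible decomposition of `A` is unique up to similarity: any two bounded
maximal abelian sets of idempotents in `{A}'` are conjugate by an invertible operator of `{A}'`. -/
def SIDUniqueUpToSimilarity (A : H →L[ℂ] H) : Prop :=
  ∀ S S' : Set (H →L[ℂ] H),
    IsBoundedMaximalAbelianIdempotentSet A S → IsBoundedMaximalAbelianIdempotentSet A S' →
    ∃ X : (H →L[ℂ] H)ˣ, (X : H →L[ℂ] H) ∈ commutant A ∧
      (fun P : H →L[ℂ] H =>
        (X : H →L[ℂ] H) * P * ((X⁻¹ : (H →L[ℂ] H)ˣ) : H →L[ℂ] H)) '' S = S'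

end Abstract

section Multiplication

variable {Λ : Type*} [MeasurableSpace Λ] {μ : Measure Λ} {n : ℕ}

/-- The multiplication operator `M_φ` on `L²(μ)`, for `φ ∈ L^∞(μ)`. -/
noncomputable def mulOp (φ : Lp ℂ ∞ μ) : Lp ℂ 2 μ →L[ℂ] Lp ℂ 2 μ :=
  (ContinuousLinearMap.mul ℂ ℂ).holderL μ ∞ 2 2 φ

theorem mulOp_coeFn (φ : Lp ℂ ∞ μ) (f : Lp ℂ 2 μ) :
    (mulOp φ f : Λ → ℂ) =ᵐ[μ] fun x => φ x * f x :=
  ContinuousLinearMap.coeFn_holder (r := 2) (ContinuousLinearMap.mul ℂ ℂ) φ f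

variable (μ n) in
/-- The Hilbert space `L²(μ)^(n)`, the orthogonal direct sum of `n` copies of `L²(μ)`. -/
abbrev L2Pow : Type _ := PiLp 2 (fun _ : Fin n => Lp ℂ 2 μ)

/-- The operator on `L²(μ)^(n)` with operator matrix `(M_{a i j})`. -/
noncomputable def matrixMulOp (a : Matrix (Fin n) (Fin n) (Lp ℂ ∞ μ)) :
    L2Pow μ n →L[ℂ] L2Pow μ n :=
  ((PiLp.continuousLinearEquiv 2 ℂ (fun _ : Fin n => Lp ℂ 2 μ)).symm :
      (Fin n → Lp ℂ 2 μ) →L[ℂ] L2Pow μ n) ∘L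
    ContinuousLinearMap.pi fun i => ∑ j, mulOp (a i j) ∘L PiLp.proj 2 (fun _ => Lp ℂ 2 μ) j

theorem matrixMulOp_apply (a : Matrix (Fin n) (Fin n) (Lp ℂ ∞ μ)) (f : L2Pow μ n) (i : Fin n) :
    matrixMulOp a f i = ∑ j, mulOp (a i j) (f j) := by
  simp [matrixMulOp]

/-- The upper triangular matrix of symbols with every diagonal entry equal to `φ` and with
`(i, j)` entry `Φ i j` for `i < j`; the values `Φ i j` with `j ≤ i` are not used. -/
noncomputable def triangularSymbol (φ : Lp ℂ ∞ μ) (Φ : Fin n → Fin n → Lp ℂ ∞ μ) :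
    Matrix (Fin n) (Fin n) (Lp ℂ ∞ μ) :=
  Matrix.of fun i j => if i < j then Φ i j else if i = j then φ else 0

/-- The upper triangular operator matrix with `M_φ` in all diagonal positions, `M_{Φ i j}` in the
positions `i < j`, and `0` below the diagonal. -/
noncomputable def triangularOp (φ : Lp ℂ ∞ μ) (Φ : Fin n → Fin n → Lp ℂ ∞ μ) :
    L2Pow μ n →L[ℂ] L2Pow μ n :=
  matrixMulOp (triangularSymbol φ Φ)

/-- The field of `n × n` matrices `x ↦ (a i j x)` given by a matrix of symbols. -/
noncomputable def fiber (a : Matrix (Fin n) (Fin n) (Lp ℂ ∞ μ)) (x : Λ) :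
    Matrix (Fin n) (Fin n) ℂ :=
  Matrix.of fun i j => (a i j : Λ → ℂ) x

variable (μ) in
/-- `T`, acting on `L²(μ)^(n) = ∫ ℂⁿ dμ`, is the direct integral of the measurable field
`x ↦ A x` of operators on `ℂⁿ`: `(T f)(x) = A x (f x)` for almost every `x`. -/
def IsDirectIntegral (T : L2Pow μ n →L[ℂ] L2Pow μ n) (A : Λ → Matrix (Fin n) (Fin n) ℂ) : Prop :=
  (∀ i j, AEStronglyMeasurable (fun x => A x i j) μ) ∧
    ∀ f : L2Pow μ n, ∀ᵐ x ∂μ, ∀ i, (T f i : Λ → ℂ) x = ∑ j, A x i j * (f j : Λ → ℂ) x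

variable (μ) in
/-- `T = ∫ A x dμ(x)` is a strongly irreducible decomposition of `T`: the integrand `A x`, an
operator on the Hilbert space `ℂⁿ`, is strongly irreducible for almost every `x`. -/
def IsSID (T : L2Pow μ n →L[ℂ] L2Pow μ n) (A : Λ → Matrix (Fin n) (Fin n) ℂ) : Prop :=
  IsDirectIntegral μ T A ∧
    ∀ᵐ x ∂μ, IsStronglyIrreducibleOp (Matrix.toEuclideanCLM (n := Fin n) (𝕜 := ℂ) (A x))

end Multiplication

end JordanSID

/-!
The operator `T = D + N` is the sum of the normal operator `D`, multiplication of all components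
by `φ`, and a nilpotent operator `N` commuting with it. The proof has three ingredients.

*Operators commuting with `T` are matrices of multiplication operators.* If `f` lives where
`|φ - c| ≤ r`, then `‖(T - c)^k f‖` grows at most like `ρ ^ k` for every `ρ > r`; conversely, this
growth forces a vector to live where `|φ - c| ≤ r` (`exists_norm_shiftedOp_pow_le`,
`vanishesOn_of_norm_shiftedOp_pow_le`). An operator commuting with `T` preserves the growth
condition, so its matrix entries preserve the set of functions vanishing on `{|φ - c| > r}`.
Countable unions and passage to the adjoint extend this to `φ⁻¹(B)` for all Borel `B`
(`preservesZeroOn_preimage`).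
As `φ` is injective almost everywhere on a standard Borel space, these are all measurable sets up
to null sets, so the entries commute with all multiplications by indicator functions and are
multiplications themselves (`exists_eq_mulOp`).

*The fibres.* Commutation with `T` is now commutation, at almost every point, with a matrix `T(x)`
that is similar to one Jordan block. A matrix commuting with such a matrix is upper triangular with
constant diagonal (`triangular_of_commute`), and if it is idempotent, it is `0` or `1`. The latter
also shows that `T(x)` is strongly irreducible.

*Idempotents.* Hence every idempotent commuting with `T` multiplies all components by one
indicator function. Such operators are projections and commute with each other, so the set of all
of them is the largest abelian set of idempotents in the commutant, and two bounded maximal ones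
are not only similar but equal.
-/

namespace JordanSID

/-! ### Operators on `L²(μ)` that preserve supports -/

section Supports

variable {Λ : Type*} [MeasurableSpace Λ] {μ : Measure Λ}

/-- On a `σ`-finite measure space some square-integrable function vanishes almost nowhere. -/
theorem exists_Lp_two_ae_ne_zero (μ : Measure Λ) [SigmaFinite μ] :
    ∃ w : Lp ℂ 2 μ, ∀ᵐ x ∂μ, (w : Λ → ℂ) x ≠ 0 := by
  obtain ⟨w, hpos, hmeas, hint⟩ :=
    exists_pos_lintegral_lt_of_sigmaFinite μ (ε := 1) one_ne_zero
  have hm : Measurable fun x => ((Real.sqrt (w x) : ℝ) : ℂ) := by fun_prop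
  have hL : MemLp (fun x => ((Real.sqrt (w x) : ℝ) : ℂ)) 2 μ := by
    rw [memLp_two_iff_integrable_sq_norm hm.aestronglyMeasurable]
    have : (fun x => ‖((Real.sqrt (w x) : ℝ) : ℂ)‖ ^ 2) = fun x => ((w x : ℝ)) := by
      funext x
      rw [Complex.norm_real, Real.norm_of_nonneg (Real.sqrt_nonneg _),
        Real.sq_sqrt (w x).coe_nonneg]
    rw [this]
    refine ⟨by fun_prop, ?_⟩
    rw [hasFiniteIntegral_iff_enorm]
    simp only [Real.enorm_of_nonneg (NNReal.coe_nonneg _), ENNReal.ofReal_coe_nnreal]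
    exact hint.trans ENNReal.one_lt_top
  refine ⟨hL.toLp _, ?_⟩
  filter_upwards [hL.coeFn_toLp] with x hx
  rw [hx]
  have : (0 : ℝ) < w x := hpos x
  exact_mod_cast (Real.sqrt_pos.2 this).ne'

theorem Lp_two_norm_sq (f : Lp ℂ 2 μ) : ‖f‖ ^ 2 = ∫ x, ‖(f : Λ → ℂ) x‖ ^ 2 ∂μ := by
  have h : ((‖f‖ ^ 2 : ℝ) : ℂ) = ((∫ x, ‖(f : Λ → ℂ) x‖ ^ 2 ∂μ : ℝ) : ℂ) := by
    rw [← integral_complex_ofReal, Complex.ofReal_pow]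
    rw [show ((‖f‖ : ℂ)) ^ 2 = inner ℂ f f from (inner_self_eq_norm_sq_to_K (𝕜 := ℂ) f).symm,
      L2.inner_def]
    refine integral_congr_ae (ae_of_all _ fun x => ?_)
    simp
  exact_mod_cast h

/-- `f` vanishes almost everywhere on `E`. -/
def VanishesOn (f : Lp ℂ 2 μ) (E : Set Λ) : Prop :=
  ∀ᵐ x ∂μ, x ∈ E → (f : Λ → ℂ) x = 0

/-- The operator `Y` maps the functions vanishing on `E` to functions vanishing on `E`. -/
def PreservesZeroOn (Y : Lp ℂ 2 μ →L[ℂ] Lp ℂ 2 μ) (E : Set Λ) : Prop :=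
  ∀ f, VanishesOn f E → VanishesOn (Y f) E

/-- The product `χ_E f` of `f` and the indicator function of `E`. -/
noncomputable def cut {E : Set Λ} (hE : MeasurableSet E) (f : Lp ℂ 2 μ) : Lp ℂ 2 μ :=
  ((Lp.memLp f).indicator hE).toLp _

theorem coeFn_cut {E : Set Λ} (hE : MeasurableSet E) (f : Lp ℂ 2 μ) :
    (cut hE f : Λ → ℂ) =ᵐ[μ] E.indicator f :=
  MemLp.coeFn_toLp _

theorem vanishesOn_cut {E : Set Λ} (hE : MeasurableSet E) (f : Lp ℂ 2 μ) :
    VanishesOn (cut hE f) Eᶜ := by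
  filter_upwards [coeFn_cut hE f] with x hx hxE
  rw [hx, Set.indicator_of_notMem hxE]

theorem cut_add_cut_compl {E : Set Λ} (hE : MeasurableSet E) (f : Lp ℂ 2 μ) :
    cut hE f + cut hE.compl f = f := by
  refine Lp.ext ?_
  filter_upwards [coeFn_cut hE f, coeFn_cut hE.compl f,
    Lp.coeFn_add (cut hE f) (cut hE.compl f)] with x h1 h2 h3
  rw [h3, Pi.add_apply, h1, h2, Set.indicator_self_add_compl_apply]

theorem PreservesZeroOn.congr {Y : Lp ℂ 2 μ →L[ℂ] Lp ℂ 2 μ} {E F : Set Λ}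
    (h : PreservesZeroOn Y E) (hEF : E =ᵐ[μ] F) : PreservesZeroOn Y F := by
  have hEF' : ∀ᵐ x ∂μ, (x ∈ E ↔ x ∈ F) := hEF.mem_iff
  intro f hf
  have hfE : VanishesOn f E := by
    filter_upwards [hf, hEF'] with x h1 h2 h3 using h1 (h2.1 h3)
  filter_upwards [h f hfE, hEF'] with x h1 h2 h3 using h1 (h2.2 h3)

theorem PreservesZeroOn.iUnion {ι : Type*} [Countable ι] {Y : Lp ℂ 2 μ →L[ℂ] Lp ℂ 2 μ}
    {E : ι → Set Λ} (h : ∀ i, PreservesZeroOn Y (E i)) : PreservesZeroOn Y (⋃ i, E i) := by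
  intro f hf
  have : ∀ i, VanishesOn (Y f) (E i) := fun i => h i f <| by
    filter_upwards [hf] with x hx hxi using hx (Set.mem_iUnion_of_mem i hxi)
  filter_upwards [ae_all_iff.2 this] with x hx hxU
  obtain ⟨i, hi⟩ := Set.mem_iUnion.1 hxU
  exact hx i hi

theorem inner_cut_right {E : Set Λ} (hE : MeasurableSet E) (f g : Lp ℂ 2 μ) :
    inner ℂ f (cut hE g) = ∫ x in E, inner ℂ ((f : Λ → ℂ) x) ((g : Λ → ℂ) x) ∂μ := by
  rw [L2.inner_def, ← integral_indicator hE]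
  refine integral_congr_ae ?_
  filter_upwards [coeFn_cut hE g] with x hx
  rw [hx]
  by_cases hxE : x ∈ E <;> simp [hxE]

theorem inner_eq_zero_of_vanishesOn {E : Set Λ} {f g : Lp ℂ 2 μ}
    (hf : VanishesOn f Eᶜ) (hg : VanishesOn g E) : inner ℂ f g = 0 := by
  rw [L2.inner_def]
  refine integral_eq_zero_of_ae ?_
  filter_upwards [hf, hg] with x h1 h2
  by_cases hx : x ∈ E
  · simp [h2 hx]
  · simp [h1 hx]

/-- The functions vanishing on `E` and those vanishing on `Eᶜ` are orthogonal complements of each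
other, so that invariance of the one under `Y` is invariance of the other under `Y†`. -/
theorem PreservesZeroOn.adjoint {Y : Lp ℂ 2 μ →L[ℂ] Lp ℂ 2 μ} {E : Set Λ}
    (hE : MeasurableSet E) (h : PreservesZeroOn Y E) :
    PreservesZeroOn (ContinuousLinearMap.adjoint Y) Eᶜ := by
  intro g hg
  set k := ContinuousLinearMap.adjoint Y g
  set u := cut hE.compl k with hu
  have huE : VanishesOn u E := by simpa using vanishesOn_cut hE.compl k
  have hku : inner ℂ k u = 0 := by
    rw [ContinuousLinearMap.adjoint_inner_left]
    exact inner_eq_zero_of_vanishesOn hg (h u huE)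
  have huu : inner ℂ u u = 0 := by
    have hk : k = cut hE k + u := (cut_add_cut_compl hE k).symm
    rwa [hk, inner_add_left, inner_eq_zero_of_vanishesOn (vanishesOn_cut hE k) huE,
      zero_add] at hku
  have hu0 : u = 0 := inner_self_eq_zero.1 huu
  filter_upwards [coeFn_cut hE.compl k, Lp.coeFn_zero ℂ 2 μ] with x h1 h2 hx
  rw [← hu, hu0, h2, Set.indicator_of_mem hx] at h1
  exact h1.symm

theorem apply_cut {Y : Lp ℂ 2 μ →L[ℂ] Lp ℂ 2 μ} (h : ∀ E, MeasurableSet E → PreservesZeroOn Y E)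
    {E : Set Λ} (hE : MeasurableSet E) (f : Lp ℂ 2 μ) : Y (cut hE f) = cut hE (Y f) := by
  have h1 := h _ hE.compl _ (vanishesOn_cut hE f)
  have h2 := h _ hE _ (by simpa using vanishesOn_cut hE.compl f)
  have h3 : Y f = Y (cut hE f) + Y (cut hE.compl f) := by
    rw [← map_add, cut_add_cut_compl]
  refine Lp.ext ?_
  filter_upwards [h1, h2, coeFn_cut hE (Y f),
    Lp.coeFn_add (Y (cut hE f)) (Y (cut hE.compl f))] with x h1 h2 h4 h5
  rw [h4]
  by_cases hx : x ∈ E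
  · rw [Set.indicator_of_mem hx, h3, h5, Pi.add_apply, h2 hx, add_zero]
  · rw [Set.indicator_of_notMem hx, h1 hx]

/-- An operator that commutes with all `χ_E` sends `w` to a function dominated by `‖Y‖ |w|`. -/
theorem ae_norm_apply_le {Y : Lp ℂ 2 μ →L[ℂ] Lp ℂ 2 μ}
    (h : ∀ E, MeasurableSet E → PreservesZeroOn Y E) (w : Lp ℂ 2 μ) :
    ∀ᵐ x ∂μ, ‖(Y w : Λ → ℂ) x‖ ≤ ‖Y‖ * ‖(w : Λ → ℂ) x‖ := by
  set E : Set Λ := {x | ‖Y‖ * ‖(w : Λ → ℂ) x‖ < ‖(Y w : Λ → ℂ) x‖} with hEdef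
  have hE : MeasurableSet E :=
    measurableSet_lt ((Lp.stronglyMeasurable w).norm.measurable.const_mul _)
      (Lp.stronglyMeasurable (Y w)).norm.measurable
  set u := cut hE w
  have hYu : Y u = cut hE (Y w) := apply_cut h hE w
  have hint : ∀ f : Lp ℂ 2 μ, Integrable (fun x => ‖(f : Λ → ℂ) x‖ ^ 2) μ := fun f =>
    (memLp_two_iff_integrable_sq_norm (Lp.aestronglyMeasurable f)).1 (Lp.memLp f)
  have hle : ∫ x, (‖(Y u : Λ → ℂ) x‖ ^ 2 - ‖Y‖ ^ 2 * ‖(u : Λ → ℂ) x‖ ^ 2) ∂μ ≤ 0 := by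
    rw [integral_sub (hint _) ((hint _).const_mul _), integral_const_mul, ← Lp_two_norm_sq,
      ← Lp_two_norm_sq, ← mul_pow]
    have := Y.le_opNorm u
    have := pow_le_pow_left₀ (norm_nonneg _) this 2
    linarith
  have hnn : 0 ≤ᵐ[μ] fun x => ‖(Y u : Λ → ℂ) x‖ ^ 2 - ‖Y‖ ^ 2 * ‖(u : Λ → ℂ) x‖ ^ 2 := by
    filter_upwards [coeFn_cut hE w, coeFn_cut hE (Y w)] with x h1 h2
    rw [hYu, h1, h2, Pi.zero_apply, ← mul_pow, sub_nonneg]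
    by_cases hx : x ∈ E
    · rw [Set.indicator_of_mem hx, Set.indicator_of_mem hx]
      exact pow_le_pow_left₀ (by positivity) (le_of_lt hx) 2
    · simp [hx]
  have hz := (integral_eq_zero_iff_of_nonneg_ae hnn
    ((hint _).sub ((hint _).const_mul _))).1 (le_antisymm hle (integral_nonneg_of_ae hnn))
  filter_upwards [hz, coeFn_cut hE w, coeFn_cut hE (Y w)] with x h0 h1 h2
  by_contra hx
  have hxE : x ∈ E := not_le.1 hx
  rw [hYu, h1, h2, Set.indicator_of_mem hxE, Set.indicator_of_mem hxE, Pi.zero_apply,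
    ← mul_pow, sub_eq_zero] at h0
  have hlt : ‖Y‖ * ‖(w : Λ → ℂ) x‖ < ‖(Y w : Λ → ℂ) x‖ := hxE
  exact (pow_lt_pow_left₀ hlt (by positivity) two_ne_zero).ne' h0

theorem preservesZeroOn_mulOp (ψ : Lp ℂ ∞ μ) (E : Set Λ) : PreservesZeroOn (mulOp ψ) E := by
  intro f hf
  filter_upwards [hf, mulOp_coeFn ψ f] with x h1 h2 hx
  rw [h2, h1 hx, mul_zero]

/-- `L^∞(μ)` is maximal abelian: an operator on `L²(μ)` that commutes with the multiplications by
indicator functions is a multiplication operator. -/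
theorem exists_eq_mulOp [SigmaFinite μ] {Y : Lp ℂ 2 μ →L[ℂ] Lp ℂ 2 μ}
    (h : ∀ E, MeasurableSet E → PreservesZeroOn Y E) : ∃ ψ : Lp ℂ ∞ μ, Y = mulOp ψ := by
  obtain ⟨w, hw⟩ := exists_Lp_two_ae_ne_zero μ
  have hψ : MemLp (fun x => (Y w : Λ → ℂ) x / (w : Λ → ℂ) x) ∞ μ := by
    refine memLp_top_of_bound ?_ ‖Y‖ ?_
    · exact (((Lp.stronglyMeasurable (Y w)).measurable).div
        (Lp.stronglyMeasurable w).measurable).aestronglyMeasurable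
    · filter_upwards [ae_norm_apply_le h w, hw] with x h1 h2
      rwa [norm_div, div_le_iff₀ (norm_pos_iff.2 h2)]
  set ψ : Lp ℂ ∞ μ := hψ.toLp _
  refine ⟨ψ, ?_⟩
  set Z := Y - mulOp ψ with hZ
  have hZw : Z w = 0 := by
    rw [hZ, sub_apply, sub_eq_zero]
    refine Lp.ext ?_
    filter_upwards [mulOp_coeFn ψ w, hψ.coeFn_toLp, hw] with x h1 h2 h3
    rw [h1, h2, div_mul_cancel₀ _ h3]
  have hZp : ∀ E, MeasurableSet E → PreservesZeroOn Z E := by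
    intro E hE f hf
    filter_upwards [h E hE f hf, preservesZeroOn_mulOp ψ E f hf,
      Lp.coeFn_sub (Y f) (mulOp ψ f)] with x h1 h2 h3 hx
    rw [hZ, sub_apply, h3, Pi.sub_apply, h1 hx, h2 hx, sub_zero]
  -- `Z†` has range orthogonal to every `χ_E w`, and these span a dense subspace
  have hadj : ∀ g, ContinuousLinearMap.adjoint Z g = 0 := by
    intro g
    set k := ContinuousLinearMap.adjoint Z g
    have hk := (L2.integrable_inner (𝕜 := ℂ) k w).ae_eq_zero_of_forall_setIntegral_eq_zero
      fun E hE _ => by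
        rw [← inner_cut_right hE k w, ContinuousLinearMap.adjoint_inner_left, apply_cut hZp, hZw]
        refine inner_eq_zero_of_vanishesOn (E := Set.univ) (by simp [VanishesOn]) ?_
        filter_upwards [coeFn_cut hE (0 : Lp ℂ 2 μ), Lp.coeFn_zero ℂ 2 μ] with x h1 h2 _
        rw [h1]
        by_cases hx : x ∈ E
        · rw [Set.indicator_of_mem hx, h2, Pi.zero_apply]
        · rw [Set.indicator_of_notMem hx]
    refine Lp.ext ?_
    filter_upwards [hk, hw, Lp.coeFn_zero ℂ 2 μ] with x h1 h2 h3
    rw [h3]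
    simpa [h2] using h1
  have hZ0 : Z = 0 := by
    ext1 f
    refine ext_inner_left ℂ fun g => ?_
    rw [← ContinuousLinearMap.adjoint_inner_left, hadj]
    simp
  exact sub_eq_zero.1 hZ0

/-- Invariance under an operator passes from the complements of discs to all Borel sets: the sets
in question are stable under countable unions, and duality supplies complements. -/
theorem preservesZeroOn_preimage {φ : Λ → ℂ} (hφ : Measurable φ) {Y : Lp ℂ 2 μ →L[ℂ] Lp ℂ 2 μ}
    (h : ∀ (c : ℂ) (r : ℝ), 0 ≤ r → PreservesZeroOn Y {x | r < ‖φ x - c‖})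
    {B : Set ℂ} (hB : MeasurableSet B) : PreservesZeroOn Y (φ ⁻¹' B) := by
  have key : ∀ (Y : Lp ℂ 2 μ →L[ℂ] Lp ℂ 2 μ),
      (∀ (c : ℂ) (r : ℝ), 0 ≤ r → PreservesZeroOn Y (φ ⁻¹' (Metric.closedBall c r)ᶜ)) →
      ∀ U : Set ℂ, IsOpen U →
        PreservesZeroOn (ContinuousLinearMap.adjoint Y) (φ ⁻¹' U) := by
    intro Y hY U hU
    have hex : ∀ z : U, ∃ δ > 0, Metric.closedBall (z : ℂ) δ ⊆ U := fun z =>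
      Metric.nhds_basis_closedBall.mem_iff.1 (hU.mem_nhds z.2)
    choose δ hδ hδU using hex
    obtain ⟨T, hT, hTU⟩ := TopologicalSpace.isOpen_iUnion_countable
      (fun z : U => Metric.ball (z : ℂ) (δ z)) fun z => Metric.isOpen_ball
    have hUeq : U = ⋃ z : T, Metric.closedBall ((z : U) : ℂ) (δ z) := by
      refine Set.Subset.antisymm (fun y hy => ?_) (Set.iUnion_subset fun z => hδU z)
      have hyT : y ∈ ⋃ z ∈ T, Metric.ball ((z : U) : ℂ) (δ z) := by
        rw [hTU]
        exact Set.mem_iUnion_of_mem ⟨y, hy⟩ (Metric.mem_ball_self (hδ _))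
      obtain ⟨z, hz, hyz⟩ := Set.mem_iUnion₂.1 hyT
      exact Set.mem_iUnion_of_mem ⟨z, hz⟩ (Metric.ball_subset_closedBall hyz)
    rw [hUeq, Set.preimage_iUnion]
    have := hT.to_subtype
    refine PreservesZeroOn.iUnion fun z => ?_
    have := (hY z (δ z) (hδ z).le).adjoint (hφ Metric.isClosed_closedBall.measurableSet.compl)
    rwa [← Set.preimage_compl, compl_compl] at this
  have hY : ∀ (c : ℂ) (r : ℝ), 0 ≤ r → PreservesZeroOn Y (φ ⁻¹' (Metric.closedBall c r)ᶜ) := by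
    intro c r hr
    convert h c r hr using 1
    ext x
    simp [dist_eq_norm]
  have hopen := key Y hY
  have hopen' := key (ContinuousLinearMap.adjoint Y)
    fun c r _ => hopen _ Metric.isClosed_closedBall.isOpen_compl
  rw [ContinuousLinearMap.adjoint_adjoint] at hopen'
  suffices hboth : PreservesZeroOn Y (φ ⁻¹' B) ∧
      PreservesZeroOn (ContinuousLinearMap.adjoint Y) (φ ⁻¹' B) from hboth.1
  induction B, hB using MeasurableSet.induction_on_open with
  | isOpen U hU => exact ⟨hopen' U hU, hopen U hU⟩
  | compl B hB ih =>
    refine ⟨?_, ih.1.adjoint (hφ hB)⟩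
    have := ih.2.adjoint (hφ hB)
    rwa [ContinuousLinearMap.adjoint_adjoint] at this
  | iUnion f _ _ ih =>
    rw [Set.preimage_iUnion]
    exact ⟨PreservesZeroOn.iUnion fun i => (ih i).1, PreservesZeroOn.iUnion fun i => (ih i).2⟩

/-- Up to null sets, an almost everywhere injective Borel function on a standard Borel space
generates the whole `σ`-algebra (Lusin–Souslin). -/
theorem exists_preimage_ae_eq [StandardBorelSpace Λ] {φ : Λ → ℂ} (hφ : Measurable φ)
    (hinj : ∃ s ∈ ae μ, Set.InjOn φ s) {E : Set Λ} (hE : MeasurableSet E) :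
    ∃ B : Set ℂ, MeasurableSet B ∧ φ ⁻¹' B =ᵐ[μ] E := by
  obtain ⟨s, hs, hinj⟩ := hinj
  obtain ⟨t, hts, htm, ht⟩ := exists_measurable_superset_of_null (mem_ae_iff.1 hs)
  have htc : tᶜ ⊆ s := Set.compl_subset_comm.1 hts
  refine ⟨φ '' (E ∩ tᶜ), (hE.inter htm.compl).image_of_measurable_injOn hφ
    (hinj.mono (Set.inter_subset_right.trans htc)), ?_⟩
  have : tᶜ ∈ ae μ := by simpa [mem_ae_iff] using ht
  refine Filter.eventuallyEq_set.2 ?_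
  filter_upwards [this] with x hx
  constructor
  · rintro ⟨y, hy, hyx⟩
    exact hinj (htc hy.2) (htc hx) hyx ▸ hy.1
  · exact fun hxE => ⟨x, ⟨hxE, hx⟩, rfl⟩

/-- If `φ` is injective almost everywhere and the operator `Y` respects every set
`{|φ - c| > r}`, then `Y` is a multiplication operator. -/
theorem exists_eq_mulOp_of_injOn [StandardBorelSpace Λ] [SigmaFinite μ] {φ : Λ → ℂ}
    (hφ : Measurable φ) (hinj : ∃ s ∈ ae μ, Set.InjOn φ s) {Y : Lp ℂ 2 μ →L[ℂ] Lp ℂ 2 μ}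
    (h : ∀ (c : ℂ) (r : ℝ), 0 ≤ r → PreservesZeroOn Y {x | r < ‖φ x - c‖}) :
    ∃ ψ : Lp ℂ ∞ μ, Y = mulOp ψ := by
  refine exists_eq_mulOp fun E hE => ?_
  obtain ⟨B, hB, hBE⟩ := exists_preimage_ae_eq hφ hinj hE
  exact (preservesZeroOn_preimage hφ h hB).congr hBE

end Supports

/-! ### Operator matrices of multiplication operators -/

section OperatorMatrices

variable {Λ : Type*} [MeasurableSpace Λ] {μ : Measure Λ} {n : ℕ}

theorem Lp_coeFn_sum {ι : Type*} (s : Finset ι) (f : ι → Lp ℂ 2 μ) :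
    ((∑ i ∈ s, f i : Lp ℂ 2 μ) : Λ → ℂ) =ᵐ[μ] fun x => ∑ i ∈ s, (f i : Λ → ℂ) x := by
  classical
  induction s using Finset.induction_on with
  | empty =>
    simp only [Finset.sum_empty]
    exact Lp.coeFn_zero ℂ 2 μ
  | insert a s ha ih =>
    rw [Finset.sum_insert ha]
    filter_upwards [ih, Lp.coeFn_add (f a) (∑ i ∈ s, f i)] with x h1 h2
    rw [h2, Pi.add_apply, h1, Finset.sum_insert ha]

@[simp]
theorem mulOp_zero : mulOp (0 : Lp ℂ ∞ μ) = 0 := by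
  simp [mulOp]

theorem isDirectIntegral_matrixMulOp (a : Matrix (Fin n) (Fin n) (Lp ℂ ∞ μ)) :
    IsDirectIntegral μ (matrixMulOp a) (fiber a) := by
  refine ⟨fun i j => Lp.aestronglyMeasurable (a i j), fun f => ae_all_iff.2 fun i => ?_⟩
  rw [matrixMulOp_apply]
  filter_upwards [Lp_coeFn_sum Finset.univ fun j => mulOp (a i j) (f j),
    ae_all_iff.2 fun j => mulOp_coeFn (a i j) (f j)] with x h1 h2
  rw [h1]
  exact Finset.sum_congr rfl fun j _ => h2 j

/-- The `(i, j)` entry of the operator matrix of `X`. -/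
noncomputable def entry (X : L2Pow μ n →L[ℂ] L2Pow μ n) (i j : Fin n) :
    Lp ℂ 2 μ →L[ℂ] Lp ℂ 2 μ :=
  PiLp.proj 2 (fun _ => Lp ℂ 2 μ) i ∘L X ∘L
    ((PiLp.continuousLinearEquiv 2 ℂ (fun _ : Fin n => Lp ℂ 2 μ)).symm :
      (Fin n → Lp ℂ 2 μ) →L[ℂ] L2Pow μ n) ∘L
    ContinuousLinearMap.single ℂ (fun _ : Fin n => Lp ℂ 2 μ) j

theorem entry_apply (X : L2Pow μ n →L[ℂ] L2Pow μ n) (i j : Fin n) (f : Lp ℂ 2 μ) :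
    entry X i j f = X (PiLp.single 2 j f) i :=
  rfl

theorem apply_eq_sum_entry (X : L2Pow μ n →L[ℂ] L2Pow μ n) (f : L2Pow μ n) (i : Fin n) :
    X f i = ∑ j, entry X i j (f j) := by
  have hf : f = ∑ j, PiLp.single 2 j (f j) := by
    ext1
    simp [WithLp.ofLp_sum]
  have h : X f = ∑ j, X (PiLp.single 2 j (f j)) := by
    conv_lhs => rw [hf]
    rw [map_sum]
  rw [h]
  simp [WithLp.ofLp_sum, entry_apply]

theorem triangularOp_apply (φ : Lp ℂ ∞ μ) (Φ : Fin n → Fin n → Lp ℂ ∞ μ) (g : L2Pow μ n)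
    (i : Fin n) :
    triangularOp φ Φ g i = mulOp φ (g i) + ∑ j ∈ Finset.Ioi i, mulOp (Φ i j) (g j) := by
  have h : (Finset.univ : Finset (Fin n)) = Finset.Iio i ∪ Finset.Ici i := by
    ext j
    simp [lt_or_ge]
  rw [triangularOp, matrixMulOp_apply, h, Finset.sum_union, Finset.sum_eq_zero, zero_add,
    ← Finset.Ioi_insert, Finset.sum_insert (by simp)]
  · congr 1
    · simp [triangularSymbol]
    · refine Finset.sum_congr rfl fun j hj => ?_
      simp [triangularSymbol, Finset.mem_Ioi.1 hj]
  · intro j hj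
    have hj : j < i := Finset.mem_Iio.1 hj
    simp [triangularSymbol, hj.not_gt, hj.ne']
  · rw [Finset.disjoint_left]
    intro j hj hj'
    exact (Finset.mem_Iio.1 hj).not_ge (Finset.mem_Ici.1 hj')

end OperatorMatrices

/-! ### Local spectral subspaces -/

section Growth

variable {Λ : Type*} [MeasurableSpace Λ] {μ : Measure Λ} {n : ℕ}

/-- The operator `T - c`, where `T` is the triangular operator with symbols `φ` and `Φ`. -/
noncomputable def shiftedOp (φ : Lp ℂ ∞ μ) (Φ : Fin n → Fin n → Lp ℂ ∞ μ) (c : ℂ) :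
    L2Pow μ n →L[ℂ] L2Pow μ n :=
  triangularOp φ Φ - c • 1

variable {φ : Lp ℂ ∞ μ} {Φ : Fin n → Fin n → Lp ℂ ∞ μ} {c : ℂ}

theorem shiftedOp_apply (g : L2Pow μ n) (i : Fin n) :
    shiftedOp φ Φ c g i =
      (mulOp φ (g i) - c • g i) + ∑ j ∈ Finset.Ioi i, mulOp (Φ i j) (g j) := by
  have : shiftedOp φ Φ c g i = triangularOp φ Φ g i - c • g i := rfl
  rw [this, triangularOp_apply, add_sub_right_comm]

theorem coeFn_mulOp_sub_smul (f : Lp ℂ 2 μ) :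
    ((mulOp φ f - c • f : Lp ℂ 2 μ) : Λ → ℂ) =ᵐ[μ]
      fun x => ((φ : Λ → ℂ) x - c) * (f : Λ → ℂ) x := by
  filter_upwards [Lp.coeFn_sub (mulOp φ f) (c • f), mulOp_coeFn φ f, Lp.coeFn_smul c f]
    with x h1 h2 h3
  rw [h1, Pi.sub_apply, h2, h3, Pi.smul_apply, smul_eq_mul, sub_mul]

theorem coeFn_shiftedOp (g : L2Pow μ n) (i : Fin n) :
    (shiftedOp φ Φ c g i : Λ → ℂ) =ᵐ[μ] fun x =>
      ((φ : Λ → ℂ) x - c) * (g i : Λ → ℂ) x +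
        ∑ j ∈ Finset.Ioi i, (Φ i j : Λ → ℂ) x * (g j : Λ → ℂ) x := by
  rw [shiftedOp_apply]
  filter_upwards [Lp.coeFn_add (mulOp φ (g i) - c • g i)
      (∑ j ∈ Finset.Ioi i, mulOp (Φ i j) (g j)), coeFn_mulOp_sub_smul (φ := φ) (c := c) (g i),
    Lp_coeFn_sum (Finset.Ioi i) fun j => mulOp (Φ i j) (g j),
    ae_all_iff.2 fun j => mulOp_coeFn (Φ i j) (g j)] with x h1 h2 h3 h4
  rw [h1, Pi.add_apply, h2, h3]
  simp only [h4]

/-- If the components of `g` from the `i`-th on vanish on `E`, the same is true of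
`(T - c)^k g`. -/
theorem vanishesOn_shiftedOp_pow {E : Set Λ} {g : L2Pow μ n} {i : Fin n}
    (hg : ∀ j, i ≤ j → VanishesOn (g j) E) (k : ℕ) :
    ∀ j, i ≤ j → VanishesOn ((shiftedOp φ Φ c ^ k) g j) E := by
  induction k with
  | zero => simpa using hg
  | succ k ih =>
    intro j hj
    rw [pow_succ']
    have hall : ∀ᵐ x ∂μ, ∀ l, i ≤ l → x ∈ E → ((shiftedOp φ Φ c ^ k) g l : Λ → ℂ) x = 0 :=
      ae_all_iff.2 fun l => Filter.eventually_imp_distrib_left.2 (ih l)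
    filter_upwards [hall, coeFn_shiftedOp (φ := φ) (Φ := Φ) (c := c)
      ((shiftedOp φ Φ c ^ k) g) j] with x h1 h2 hx
    refine h2.trans ?_
    rw [h1 j hj hx, mul_zero, zero_add]
    exact Finset.sum_eq_zero fun l hl => by
      rw [h1 l (hj.trans (Finset.mem_Ioi.1 hl).le) hx, mul_zero]

theorem exists_geometric_bound {a : ℕ → ℝ} {r ρ B : ℝ} (hr : 0 ≤ r) (hρ : r < ρ) (hB : 0 ≤ B)
    (h : ∀ k, a (k + 1) ≤ r * a k + B * ρ ^ k) : ∃ C, 0 ≤ C ∧ ∀ k, a k ≤ C * ρ ^ k := by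
  have hρ0 : 0 < ρ - r := sub_pos.2 hρ
  -- `C` is chosen so that `r C + B ≤ ρ C`
  refine ⟨max (a 0) (B / (ρ - r)), le_max_of_le_right (by positivity), fun k => ?_⟩
  set C := max (a 0) (B / (ρ - r))
  have hC : B ≤ C * (ρ - r) := (div_le_iff₀ hρ0).1 (le_max_right _ _)
  induction k with
  | zero =>
    rw [pow_zero, mul_one]
    exact le_max_left _ _
  | succ k ih =>
    have hp : 0 ≤ ρ ^ k := pow_nonneg (hr.trans hρ.le) k
    calc a (k + 1) ≤ r * a k + B * ρ ^ k := h k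
      _ ≤ r * (C * ρ ^ k) + C * (ρ - r) * ρ ^ k := by gcongr
      _ = C * ρ ^ (k + 1) := by ring

/-- If `f` lives where `|φ - c| ≤ r`, then `(T - c)^k f` grows at most like `ρ ^ k` for each
`ρ > r`. The components are bounded from the last to the first. -/
theorem exists_norm_shiftedOp_pow_le {r ρ : ℝ} (hr : 0 ≤ r) (hρ : r < ρ) {f : L2Pow μ n}
    (hf : ∀ i, VanishesOn (f i) {x | r < ‖(φ : Λ → ℂ) x - c‖}) (i : Fin n) :
    ∃ C, 0 ≤ C ∧ ∀ k, ‖(shiftedOp φ Φ c ^ k) f i‖ ≤ C * ρ ^ k := by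
  induction i using WellFoundedGT.induction with
  | ind i ih =>
    choose! C hC0 hC using ih
    refine exists_geometric_bound hr hρ (B := ∑ j ∈ Finset.Ioi i, ‖mulOp (Φ i j)‖ * C j)
      (Finset.sum_nonneg fun j hj => mul_nonneg (norm_nonneg _) (hC0 j (Finset.mem_Ioi.1 hj)))
      fun k => ?_
    set g := (shiftedOp φ Φ c ^ k) f with hg
    have hgv : VanishesOn (g i) {x | r < ‖(φ : Λ → ℂ) x - c‖} :=
      vanishesOn_shiftedOp_pow (i := i) (fun j _ => hf j) k i le_rfl
    have h1 : ‖mulOp φ (g i) - c • g i‖ ≤ r * ‖g i‖ := by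
      refine Lp.norm_le_mul_norm_of_ae_le_mul ?_
      filter_upwards [coeFn_mulOp_sub_smul (φ := φ) (c := c) (g i), hgv] with x h1 h2
      rw [h1, norm_mul]
      by_cases hx : r < ‖(φ : Λ → ℂ) x - c‖
      · rw [h2 hx]
        simp
      · gcongr
        exact not_lt.1 hx
    have h2 : (shiftedOp φ Φ c ^ (k + 1)) f = shiftedOp φ Φ c g := by
      rw [pow_succ']
      rfl
    rw [h2, shiftedOp_apply]
    refine (norm_add_le _ _).trans (add_le_add h1 ((norm_sum_le _ _).trans ?_))
    rw [Finset.sum_mul]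
    refine Finset.sum_le_sum fun j hj => ((mulOp (Φ i j)).le_opNorm _).trans ?_
    rw [mul_assoc]
    gcongr
    exact hC j (Finset.mem_Ioi.1 hj) k

/-- If `(T - c)^k g` grows at most like `ρ ^ k`, then `g` vanishes where `|φ - c| ≥ R` for each
`R > ρ`: once the components after the `i`-th are known to vanish there, `(T - c)^k` multiplies
the `i`-th one by `(φ - c)^k`. -/
theorem vanishesOn_of_norm_shiftedOp_pow_le {ρ R : ℝ} (hρ0 : 0 ≤ ρ) (hR : ρ < R)
    {g : L2Pow μ n} (hg : ∀ i, ∃ C, 0 ≤ C ∧ ∀ k, ‖(shiftedOp φ Φ c ^ k) g i‖ ≤ C * ρ ^ k)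
    (i : Fin n) : VanishesOn (g i) {x | R ≤ ‖(φ : Λ → ℂ) x - c‖} := by
  have hR0 : 0 < R := hρ0.trans_lt hR
  set E : Set Λ := {x | R ≤ ‖(φ : Λ → ℂ) x - c‖} with hEdef
  have hE : MeasurableSet E := by
    have := (Lp.stronglyMeasurable φ).measurable
    exact measurableSet_le measurable_const (this.sub_const c).norm
  induction i using WellFoundedGT.induction with
  | ind i ih =>
    obtain ⟨C, hC0, hC⟩ := hg i
    have hlater : ∀ k, ∀ j, i < j → VanishesOn ((shiftedOp φ Φ c ^ k) g j) E := fun k j hj =>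
      vanishesOn_shiftedOp_pow (i := j) (fun l hl => ih l (hj.trans_le hl)) k j le_rfl
    have hstep : ∀ k, ‖cut hE ((shiftedOp φ Φ c ^ k) g i)‖ ≤
        R⁻¹ * ‖cut hE ((shiftedOp φ Φ c ^ (k + 1)) g i)‖ := by
      intro k
      refine Lp.norm_le_mul_norm_of_ae_le_mul ?_
      have hall : ∀ᵐ x ∂μ, ∀ j, i < j → x ∈ E → ((shiftedOp φ Φ c ^ k) g j : Λ → ℂ) x = 0 :=
        ae_all_iff.2 fun j => Filter.eventually_imp_distrib_left.2 (hlater k j)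
      filter_upwards [coeFn_cut hE ((shiftedOp φ Φ c ^ k) g i),
        coeFn_cut hE ((shiftedOp φ Φ c ^ (k + 1)) g i), hall,
        coeFn_shiftedOp (φ := φ) (Φ := Φ) (c := c) ((shiftedOp φ Φ c ^ k) g) i]
        with x h1 h2 h3 h4
      rw [h1, h2]
      by_cases hx : x ∈ E
      · rw [Set.indicator_of_mem hx, Set.indicator_of_mem hx, pow_succ',
          mul_apply_eq_comp, h4, Finset.sum_eq_zero, add_zero, norm_mul,
          ← mul_assoc]
        · refine le_mul_of_one_le_left (norm_nonneg _) ?_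
          rw [inv_mul_eq_div, one_le_div hR0]
          exact hx
        · intro j hj
          rw [h3 j (Finset.mem_Ioi.1 hj) hx, mul_zero]
      · simp [hx]
    have hpow : ∀ k, ‖cut hE (g i)‖ ≤ R⁻¹ ^ k * ‖cut hE ((shiftedOp φ Φ c ^ k) g i)‖ := by
      intro k
      induction k with
      | zero => simp
      | succ k ihk =>
        refine ihk.trans ?_
        rw [pow_succ, mul_assoc]
        gcongr
        exact hstep k
    have hcut : ∀ f : Lp ℂ 2 μ, ‖cut hE f‖ ≤ ‖f‖ := by
      intro f
      refine Lp.norm_le_norm_of_ae_le ?_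
      filter_upwards [coeFn_cut hE f] with x hx
      rw [hx]
      exact norm_indicator_le_norm_self _ _
    have hle : ∀ k, ‖cut hE (g i)‖ ≤ C * (ρ / R) ^ k := by
      intro k
      calc ‖cut hE (g i)‖ ≤ R⁻¹ ^ k * (C * ρ ^ k) :=
            (hpow k).trans (by gcongr; exact (hcut _).trans (hC k))
        _ = C * (ρ / R) ^ k := by rw [div_pow, inv_pow]; ring
    have hlim : Filter.Tendsto (fun k : ℕ => C * (ρ / R) ^ k) Filter.atTop (nhds (C * 0)) :=
      (tendsto_pow_atTop_nhds_zero_of_lt_one (by positivity)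
        ((div_lt_one hR0).2 hR)).const_mul C
    rw [mul_zero] at hlim
    have h0 : cut hE (g i) = 0 := norm_le_zero_iff.1 (ge_of_tendsto' hlim hle)
    filter_upwards [coeFn_cut hE (g i), Lp.coeFn_zero ℂ 2 μ] with x h1 h2 hx
    rw [h0, h2, Set.indicator_of_mem hx] at h1
    exact h1.symm

theorem commute_shiftedOp_pow {X : L2Pow μ n →L[ℂ] L2Pow μ n}
    (hX : X ∈ commutant (triangularOp φ Φ)) (k : ℕ) : Commute X (shiftedOp φ Φ c ^ k) := by
  have h : Commute X (triangularOp φ Φ) := (hX _ rfl).symm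
  exact (h.sub_right ((Commute.one_right X).smul_right c)).pow_right k

/-- The entries of an operator commuting with `T` respect the sets `{|φ - c| > r}`. -/
theorem preservesZeroOn_entry {X : L2Pow μ n →L[ℂ] L2Pow μ n}
    (hX : X ∈ commutant (triangularOp φ Φ)) (i j : Fin n) (c : ℂ) {r : ℝ} (hr : 0 ≤ r) :
    PreservesZeroOn (entry X i j) {x | r < ‖(φ : Λ → ℂ) x - c‖} := by
  intro f hf
  set F : L2Pow μ n := PiLp.single 2 j f with hF
  have hFv : ∀ l, VanishesOn (F l) {x | r < ‖(φ : Λ → ℂ) x - c‖} := by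
    intro l
    by_cases hl : l = j
    · subst hl
      simpa [hF] using hf
    · have : F l = 0 := by simp [hF, hl]
      rw [this]
      filter_upwards [Lp.coeFn_zero ℂ 2 μ] with x hx _ using hx
  have hgrow : ∀ ρ, r < ρ → ∀ l, ∃ C, 0 ≤ C ∧
      ∀ k, ‖(shiftedOp φ Φ c ^ k) (X F) l‖ ≤ C * ρ ^ k := by
    intro ρ hρ l
    choose C hC0 hC using exists_norm_shiftedOp_pow_le (Φ := Φ) hr hρ hFv
    refine ⟨∑ m, ‖entry X l m‖ * C m,
      Finset.sum_nonneg fun m _ => mul_nonneg (norm_nonneg _) (hC0 m), fun k => ?_⟩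
    have hk : (shiftedOp φ Φ c ^ k) (X F) = X ((shiftedOp φ Φ c ^ k) F) :=
      (DFunLike.congr_fun (commute_shiftedOp_pow hX k).eq F).symm
    rw [hk, apply_eq_sum_entry, Finset.sum_mul]
    refine (norm_sum_le _ _).trans (Finset.sum_le_sum fun m _ => ?_)
    refine ((entry X l m).le_opNorm _).trans ?_
    rw [mul_assoc]
    gcongr
    exact hC m k
  have hv : ∀ m : ℕ, VanishesOn (X F i) {x | r + 1 / (m + 1) ≤ ‖(φ : Λ → ℂ) x - c‖} := by
    intro m
    have hm : (0 : ℝ) < 1 / (m + 1) := Nat.one_div_pos_of_nat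
    exact vanishesOn_of_norm_shiftedOp_pow_le (ρ := r + 1 / (m + 1) / 2) (by positivity)
      (by linarith) (hgrow _ (by linarith)) i
  rw [entry_apply]
  filter_upwards [ae_all_iff.2 hv] with x hx hxr
  obtain ⟨m, hm⟩ := exists_nat_one_div_lt (sub_pos.2 hxr)
  exact hx m (by linarith)

/-- Every operator commuting with `T` is a matrix of multiplication operators. -/
theorem exists_eq_matrixMulOp [StandardBorelSpace Λ] [SigmaFinite μ]
    (hφ : ∃ s ∈ ae μ, Set.InjOn (φ : Λ → ℂ) s) {X : L2Pow μ n →L[ℂ] L2Pow μ n}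
    (hX : X ∈ commutant (triangularOp φ Φ)) :
    ∃ a : Matrix (Fin n) (Fin n) (Lp ℂ ∞ μ), X = matrixMulOp a := by
  have h : ∀ i j, ∃ ψ : Lp ℂ ∞ μ, entry X i j = mulOp ψ := fun i j =>
    exists_eq_mulOp_of_injOn (Lp.stronglyMeasurable φ).measurable hφ
      fun c r hr => preservesZeroOn_entry hX i j c hr
  choose a ha using h
  refine ⟨Matrix.of a, ?_⟩
  ext1 f
  ext1 i
  rw [apply_eq_sum_entry, matrixMulOp_apply]
  simp [ha]

end Growth

/-! ### Matrices commuting with a triangular matrix -/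

section Matrices

variable {n : ℕ}

/-- A matrix commuting with an upper triangular matrix that has constant diagonal and nonzero
entries above the diagonal is itself upper triangular with constant diagonal. -/
theorem triangular_of_commute {A N : Matrix (Fin n) (Fin n) ℂ} {d : ℂ}
    (hlow : ∀ i j, j < i → N i j = 0) (hdiag : ∀ i, N i i = d)
    (hsup : ∀ i j : Fin n, (j : ℕ) = i + 1 → N i j ≠ 0) (hAN : A * N = N * A) :
    (∀ i j, j < i → A i j = 0) ∧ ∀ i j, A i i = A j j := by
  -- only the nilpotent part of `N` matters
  set M := N - Matrix.scalar (Fin n) d with hM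
  have hM0 : ∀ i j, j ≤ i → M i j = 0 := by
    intro i j hij
    rcases hij.eq_or_lt with rfl | hlt
    · simp [hM, hdiag]
    · simp [hM, hlow i j hlt, Matrix.diagonal_apply_ne _ hlt.ne']
  have hMs : ∀ i j : Fin n, (j : ℕ) = i + 1 → M i j ≠ 0 := by
    intro i j hij
    have : i ≠ j := fun h => by subst h; omega
    simpa [hM, Matrix.diagonal_apply_ne _ this] using hsup i j hij
  have hAM : ∀ i j, ∑ k, A i k * M k j = ∑ k, M i k * A k j := by
    intro i j
    have h : A * M = M * A := by
      rw [hM, mul_sub, sub_mul, hAN, (Matrix.scalar_commute d (fun _ => Commute.all _ _) A).eq]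
    simpa [Matrix.mul_apply] using congrFun (congrFun h i) j
  have htri : ∀ j i, j < i → A i j = 0 := by
    intro j
    induction j using WellFoundedLT.induction with
    | ind j ihj =>
      intro i
      induction i using WellFoundedGT.induction with
      | ind i ihi =>
        intro hji
        obtain ⟨p, hp⟩ : ∃ p : Fin n, (i : ℕ) = p + 1 := ⟨⟨i - 1, by omega⟩, by
          have : (j : ℕ) < i := hji
          simp only
          omega⟩
        have hjp : j ≤ p := by
          have : (j : ℕ) < i := hji
          rw [Fin.le_def]
          omega
        have h := hAM p j
        rw [Finset.sum_eq_zero, Finset.sum_eq_single i] at h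
        · exact (mul_eq_zero.1 h.symm).resolve_left (hMs p i hp)
        · intro k _ hki
          by_cases hkp : k ≤ p
          · rw [hM0 p k hkp, zero_mul]
          · have hik : i < k := by
              rw [Fin.lt_def]
              have h1 : (k : ℕ) ≠ i := fun h => hki (Fin.ext h)
              have h2 : (p : ℕ) < k := not_le.1 hkp
              omega
            rw [ihi k hik (hji.trans hik), mul_zero]
        · simp
        · intro k _
          by_cases hkj : k < j
          · rw [ihj k hkj p (hkj.trans_le hjp), zero_mul]
          · rw [hM0 k j (not_lt.1 hkj), mul_zero]
  have hstep : ∀ i j : Fin n, (j : ℕ) = i + 1 → A i i = A j j := by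
    intro i j hij
    have h := hAM i j
    rw [Finset.sum_eq_single i, Finset.sum_eq_single j] at h
    · rw [mul_comm] at h
      exact mul_left_cancel₀ (hMs i j hij) h
    · intro k _ hk
      by_cases hki : k ≤ i
      · rw [hM0 i k hki, zero_mul]
      · rw [htri j k, mul_zero]
        have h1 : (k : ℕ) ≠ j := fun h => hk (Fin.ext h)
        have h2 : (i : ℕ) < k := not_le.1 hki
        rw [Fin.lt_def]
        omega
    · simp
    · intro k _ hk
      by_cases hki : k < i
      · rw [htri k i hki, zero_mul]
      · rw [hM0 k j, mul_zero]
        have h1 : (k : ℕ) ≠ i := fun h => hk (Fin.ext h)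
        have h2 : (i : ℕ) ≤ k := not_lt.1 hki
        rw [Fin.le_def]
        omega
    · simp
  refine ⟨fun i j => htri j i, ?_⟩
  have h0 : ∀ (m : ℕ) (i j : Fin n), (j : ℕ) = i + m → A i i = A j j := by
    intro m
    induction m with
    | zero => intro i j h; rw [Fin.ext (h.trans (add_zero _))]
    | succ m ih =>
      intro i j h
      have hlt : (i : ℕ) + m < n := by omega
      exact (ih i ⟨i + m, hlt⟩ rfl).trans (hstep _ j (by simp only; omega))
  intro i j
  rcases le_total i j with h | h
  · exact h0 (j - i) i j (by have : (i : ℕ) ≤ j := h; omega)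
  · exact (h0 (i - j) j i (by have : (j : ℕ) ≤ i := h; omega)).symm

/-- A strictly upper triangular idempotent vanishes. -/
theorem eq_zero_of_idempotent_of_strictly_upper {A : Matrix (Fin n) (Fin n) ℂ}
    (hA : ∀ i j, j ≤ i → A i j = 0) (hid : A * A = A) : A = 0 := by
  suffices h : ∀ (m : ℕ) (i j : Fin n), (j : ℕ) ≤ i + m → A i j = 0 by
    ext i j
    exact h n i j (by omega)
  intro m
  induction m with
  | zero => exact fun i j h => hA i j (by simpa using h)
  | succ m ih =>
    intro i j h
    rw [← hid, Matrix.mul_apply]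
    refine Finset.sum_eq_zero fun k _ => ?_
    by_cases hki : k ≤ i
    · rw [hA i k hki, zero_mul]
    · have : (i : ℕ) < k := not_le.1 hki
      rw [ih k j (by omega), mul_zero]

/-- An upper triangular idempotent with constant diagonal is `0` or `1`. -/
theorem eq_zero_or_one_of_idempotent {A : Matrix (Fin n) (Fin n) ℂ}
    (hlow : ∀ i j, j < i → A i j = 0) (hdiag : ∀ i j, A i i = A j j) (hid : A * A = A) :
    A = 0 ∨ A = 1 := by
  by_cases h0 : ∀ i, A i i = 0
  · refine Or.inl (eq_zero_of_idempotent_of_strictly_upper (fun i j hij => ?_) hid)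
    rcases hij.eq_or_lt with rfl | h
    exacts [h0 _, hlow i j h]
  · push Not at h0
    obtain ⟨i₀, hi₀⟩ := h0
    have h1 : A i₀ i₀ = 1 := by
      have h := congrFun (congrFun hid i₀) i₀
      rw [Matrix.mul_apply, Finset.sum_eq_single i₀] at h
      · exact mul_left_cancel₀ hi₀ (h.trans (mul_one _).symm)
      · intro k _ hk
        rcases lt_or_gt_of_ne hk with hlt | hlt
        · rw [hlow i₀ k hlt, zero_mul]
        · rw [hlow k i₀ hlt, mul_zero]
      · simp
    refine Or.inr (sub_eq_zero.1 (eq_zero_of_idempotent_of_strictly_upper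
      (A := 1 - A) (fun i j hij => ?_) ?_)).symm
    · rcases hij.eq_or_lt with rfl | h
      · simp [hdiag j i₀, h1]
      · simp [hlow i j h, Matrix.one_apply_ne h.ne']
    · rw [mul_sub, sub_mul, sub_mul, hid]
      simp

/-- An idempotent commuting with an upper triangular matrix that has constant diagonal and nonzero
entries above the diagonal is `0` or `1`. -/
theorem eq_zero_or_one_of_idempotent_of_commute {A N : Matrix (Fin n) (Fin n) ℂ} {d : ℂ}
    (hlow : ∀ i j, j < i → N i j = 0) (hdiag : ∀ i, N i i = d)
    (hsup : ∀ i j : Fin n, (j : ℕ) = i + 1 → N i j ≠ 0) (hAN : A * N = N * A)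
    (hid : A * A = A) : A = 0 ∨ A = 1 :=
  have h := triangular_of_commute hlow hdiag hsup hAN
  eq_zero_or_one_of_idempotent h.1 h.2 hid

/-- An upper triangular matrix with constant diagonal and nonzero entries above the diagonal is
similar to a single Jordan block, hence strongly irreducible. -/
theorem isStronglyIrreducibleOp_of_triangular {N : Matrix (Fin n) (Fin n) ℂ} {d : ℂ}
    (hlow : ∀ i j, j < i → N i j = 0) (hdiag : ∀ i, N i i = d)
    (hsup : ∀ i j : Fin n, (j : ℕ) = i + 1 → N i j ≠ 0) :
    IsStronglyIrreducibleOp (Matrix.toEuclideanCLM (n := Fin n) (𝕜 := ℂ) N) := by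
  intro X P hP hPP
  set e := Matrix.toEuclideanCLM (n := Fin n) (𝕜 := ℂ)
  obtain ⟨x, y, hxy, hyx⟩ := X
  change P ∈ commutant (x * e N * y) at hP
  have hcomm : x * e N * y * P = P * (x * e N * y) := hP _ rfl
  -- `y P x` is an idempotent in the commutant of `N`
  have hPQ : P = x * (y * P * x) * y := by
    rw [← mul_assoc, ← mul_assoc, hxy, one_mul, mul_assoc, hxy, mul_one]
  have hQN : y * P * x * e N = e N * (y * P * x) := by
    calc y * P * x * e N = y * (P * (x * e N * y)) * x := by
          simp only [mul_assoc, hyx, mul_one]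
      _ = y * x * e N * (y * P * x) := by rw [← hcomm]; simp only [mul_assoc]
      _ = e N * (y * P * x) := by rw [hyx, one_mul]
  have hQQ : y * P * x * (y * P * x) = y * P * x := by
    calc y * P * x * (y * P * x) = y * P * (x * y) * (P * x) := by simp only [mul_assoc]
      _ = y * (P * P) * x := by rw [hxy, mul_one]; simp only [mul_assoc]
      _ = y * P * x := by rw [hPP.isIdempotentElem.eq]
  obtain ⟨A, hA : e A = y * P * x⟩ := EquivLike.surjective e (y * P * x)
  rw [← hA, ← map_mul, ← map_mul] at hQN
  rw [← hA, ← map_mul] at hQQ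
  rw [← hA] at hPQ
  rcases eq_zero_or_one_of_idempotent_of_commute hlow hdiag hsup (EquivLike.injective e hQN)
    (EquivLike.injective e hQQ) with h | h
  · left
    rw [hPQ, h, map_zero, mul_zero, zero_mul]
  · right
    rw [hPQ, h, map_one, mul_one, hxy]

end Matrices

/-! ### Direct integrals of matrices -/

section DirectIntegrals

variable {Λ : Type*} [MeasurableSpace Λ] {μ : Measure Λ} {n : ℕ}

theorem IsDirectIntegral.mul {S T : L2Pow μ n →L[ℂ] L2Pow μ n}
    {A B : Λ → Matrix (Fin n) (Fin n) ℂ} (hS : IsDirectIntegral μ S A)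
    (hT : IsDirectIntegral μ T B) : IsDirectIntegral μ (S * T) fun x => A x * B x := by
  refine ⟨fun i j => ?_, fun f => ?_⟩
  · simp only [Matrix.mul_apply]
    exact Finset.aestronglyMeasurable_fun_sum _ fun k _ => (hS.1 i k).mul (hT.1 k j)
  · filter_upwards [hS.2 (T f), hT.2 f] with x h1 h2 i
    refine (h1 i).trans ?_
    simp only [h2, Matrix.mul_apply, Finset.mul_sum, Finset.sum_mul]
    rw [Finset.sum_comm]
    simp only [mul_assoc]

/-- The integrand of a direct integral is determined almost everywhere. -/
theorem IsDirectIntegral.ae_eq [SigmaFinite μ] {T : L2Pow μ n →L[ℂ] L2Pow μ n}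
    {A B : Λ → Matrix (Fin n) (Fin n) ℂ} (hA : IsDirectIntegral μ T A)
    (hB : IsDirectIntegral μ T B) : ∀ᵐ x ∂μ, A x = B x := by
  obtain ⟨w, hw⟩ := exists_Lp_two_ae_ne_zero μ
  have hs : ∀ᵐ x ∂μ, ∀ j k : Fin n, ((PiLp.single 2 j w : L2Pow μ n) k : Λ → ℂ) x =
      if k = j then (w : Λ → ℂ) x else 0 := by
    refine ae_all_iff.2 fun j => ae_all_iff.2 fun k => ?_
    by_cases h : k = j
    · subst h
      simp
    · filter_upwards [Lp.coeFn_zero ℂ 2 μ] with x hx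
      rw [PiLp.single_eq_of_ne 2 h, hx, if_neg h, Pi.zero_apply]
  filter_upwards [hw, hs, ae_all_iff.2 fun j => hA.2 (PiLp.single 2 j w),
    ae_all_iff.2 fun j => hB.2 (PiLp.single 2 j w)] with x hwx hsx h1 h2
  ext i j
  have h := (h1 j i).symm.trans (h2 j i)
  simp only [hsx, mul_ite, mul_zero, Finset.sum_ite_eq', Finset.mem_univ, if_true] at h
  exact mul_right_cancel₀ hwx h

theorem ae_commute_fiber [SigmaFinite μ] {a b : Matrix (Fin n) (Fin n) (Lp ℂ ∞ μ)}
    (h : matrixMulOp a ∈ commutant (matrixMulOp b)) :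
    ∀ᵐ x ∂μ, fiber a x * fiber b x = fiber b x * fiber a x := by
  have ha := isDirectIntegral_matrixMulOp a
  have hb := isDirectIntegral_matrixMulOp b
  refine (ha.mul hb).ae_eq ?_
  rw [← h _ rfl]
  exact hb.mul ha

theorem ae_fiber_triangularSymbol (φ : Lp ℂ ∞ μ) (Φ : Fin n → Fin n → Lp ℂ ∞ μ) :
    ∀ᵐ x ∂μ, (∀ i j, j < i → fiber (triangularSymbol φ Φ) x i j = 0) ∧
      (∀ i, fiber (triangularSymbol φ Φ) x i i = (φ : Λ → ℂ) x) ∧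
      ∀ i j, i < j → fiber (triangularSymbol φ Φ) x i j = (Φ i j : Λ → ℂ) x := by
  filter_upwards [Lp.coeFn_zero ℂ ∞ μ] with x hx
  refine ⟨fun i j h => ?_, fun i => ?_, fun i j h => ?_⟩
  · simp only [fiber, triangularSymbol, Matrix.of_apply, h.not_gt, h.ne', if_false]
    exact hx
  · simp [fiber, triangularSymbol]
  · simp [fiber, triangularSymbol, h]

/-- The conditions on the symbols of `T`, as conditions on almost every fibre. -/
theorem ae_fiber_jordan {φ : Lp ℂ ∞ μ} {Φ : Fin n → Fin n → Lp ℂ ∞ μ}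
    (hΦ : ∀ i j : Fin n, (j : ℕ) = (i : ℕ) + 1 → ∀ᵐ x ∂μ, (Φ i j : Λ → ℂ) x ≠ 0) :
    ∀ᵐ x ∂μ, (∀ i j, j < i → fiber (triangularSymbol φ Φ) x i j = 0) ∧
      (∀ i, fiber (triangularSymbol φ Φ) x i i = (φ : Λ → ℂ) x) ∧
      ∀ i j : Fin n, (j : ℕ) = i + 1 → fiber (triangularSymbol φ Φ) x i j ≠ 0 := by
  have hΦ' : ∀ᵐ x ∂μ, ∀ i j : Fin n, (j : ℕ) = (i : ℕ) + 1 → (Φ i j : Λ → ℂ) x ≠ 0 :=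
    ae_all_iff.2 fun i => ae_all_iff.2 fun j => Filter.eventually_imp_distrib_left.2 (hΦ i j)
  filter_upwards [hΦ', ae_fiber_triangularSymbol φ Φ] with x h1 h2
  refine ⟨h2.1, h2.2.1, fun i j hij => ?_⟩
  rw [h2.2.2 i j (by rw [Fin.lt_def]; omega)]
  exact h1 i j hij

theorem isSID_triangularOp {φ : Lp ℂ ∞ μ} {Φ : Fin n → Fin n → Lp ℂ ∞ μ}
    (hΦ : ∀ i j : Fin n, (j : ℕ) = (i : ℕ) + 1 → ∀ᵐ x ∂μ, (Φ i j : Λ → ℂ) x ≠ 0) :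
    IsSID μ (triangularOp φ Φ) (fiber (triangularSymbol φ Φ)) := by
  refine ⟨isDirectIntegral_matrixMulOp _, ?_⟩
  filter_upwards [ae_fiber_jordan (φ := φ) hΦ] with x hx
  exact isStronglyIrreducibleOp_of_triangular hx.1 hx.2.1 hx.2.2

end DirectIntegrals

/-! ### Idempotents acting as scalars on the fibres -/

section Idempotents

variable {Λ : Type*} [MeasurableSpace Λ] {μ : Measure Λ} {n : ℕ}

/-- `P` is multiplication of all components by one function with values in `{0, 1}`,
whose measurability is not demanded. -/
def IsFiberwiseZeroOne (P : L2Pow μ n →L[ℂ] L2Pow μ n) : Prop :=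
  ∃ e : Λ → ℂ, (∀ x, e x = 0 ∨ e x = 1) ∧
    ∀ f : L2Pow μ n, ∀ᵐ x ∂μ, ∀ i, (P f i : Λ → ℂ) x = e x * (f i : Λ → ℂ) x

theorem isFiberwiseZeroOne_of_ae {a : Matrix (Fin n) (Fin n) (Lp ℂ ∞ μ)}
    (h : ∀ᵐ x ∂μ, fiber a x = 0 ∨ fiber a x = 1) : IsFiberwiseZeroOne (matrixMulOp a) := by
  classical
  refine ⟨fun x => if fiber a x = 0 then 0 else 1, fun x => ?_, fun f => ?_⟩
  · by_cases hx : fiber a x = 0 <;> simp [hx]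
  · filter_upwards [h, (isDirectIntegral_matrixMulOp a).2 f] with x h1 h2 i
    rw [h2]
    by_cases hx : fiber a x = 0
    · simp [hx]
    · rw [if_neg hx, h1.resolve_left hx]
      simp [Matrix.one_apply]

theorem L2Pow_ext {f g : L2Pow μ n} (h : ∀ᵐ x ∂μ, ∀ i, (f i : Λ → ℂ) x = (g i : Λ → ℂ) x) :
    f = g := by
  ext1 i
  refine Lp.ext ?_
  filter_upwards [h] with x hx using hx i

theorem IsFiberwiseZeroOne.isIdempotentElem {P : L2Pow μ n →L[ℂ] L2Pow μ n}
    (hP : IsFiberwiseZeroOne P) : IsIdempotentElem P := by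
  obtain ⟨e, he, hPe⟩ := hP
  refine ContinuousLinearMap.ext fun f => L2Pow_ext ?_
  filter_upwards [hPe f, hPe (P f)] with x h1 h2 i
  refine (h2 i).trans ?_
  rw [h1 i]
  rcases he x with h | h <;> simp [h]

theorem IsFiberwiseZeroOne.isStarProjection {P : L2Pow μ n →L[ℂ] L2Pow μ n}
    (hP : IsFiberwiseZeroOne P) : IsStarProjection P := by
  refine ⟨hP.isIdempotentElem, ContinuousLinearMap.isSelfAdjoint_iff_isSymmetric.2 ?_⟩
  obtain ⟨e, he, hPe⟩ := hP
  intro f g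
  change inner ℂ (P f) g = inner ℂ f (P g)
  simp only [PiLp.inner_apply, L2.inner_def]
  refine Finset.sum_congr rfl fun i _ => integral_congr_ae ?_
  filter_upwards [hPe f, hPe g] with x h1 h2
  rw [h1 i, h2 i]
  rcases he x with h | h <;> simp [h]

theorem IsFiberwiseZeroOne.commute {P Q : L2Pow μ n →L[ℂ] L2Pow μ n}
    (hP : IsFiberwiseZeroOne P) (hQ : IsFiberwiseZeroOne Q) : Commute P Q := by
  obtain ⟨e, -, hPe⟩ := hP
  obtain ⟨e', -, hQe⟩ := hQ
  refine ContinuousLinearMap.ext fun f => L2Pow_ext ?_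
  filter_upwards [hPe f, hPe (Q f), hQe f, hQe (P f)] with x h1 h2 h3 h4 i
  refine (h2 i).trans (Eq.trans ?_ (h4 i).symm)
  rw [h1 i, h3 i]
  ring

end Idempotents

/-! ### The commutant of the triangular operator -/

section Commutant

variable {Λ : Type*} [MeasurableSpace Λ] [StandardBorelSpace Λ] {μ : Measure Λ} [SigmaFinite μ]
  {n : ℕ} {φ : Lp ℂ ∞ μ} {Φ : Fin n → Fin n → Lp ℂ ∞ μ}

theorem exists_eq_triangularOp (hn : 1 ≤ n)
    (hΦ : ∀ i j : Fin n, (j : ℕ) = (i : ℕ) + 1 → ∀ᵐ x ∂μ, (Φ i j : Λ → ℂ) x ≠ 0)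
    (hφ : ∃ s ∈ ae μ, Set.InjOn (φ : Λ → ℂ) s) {X : L2Pow μ n →L[ℂ] L2Pow μ n}
    (hX : X ∈ commutant (triangularOp φ Φ)) :
    ∃ (ψ : Lp ℂ ∞ μ) (Ψ : Fin n → Fin n → Lp ℂ ∞ μ), X = triangularOp ψ Ψ := by
  obtain ⟨a, rfl⟩ := exists_eq_matrixMulOp hφ hX
  have htri : ∀ᵐ x ∂μ, (∀ i j, j < i → fiber a x i j = 0) ∧
      ∀ i j, fiber a x i i = fiber a x j j := by
    filter_upwards [ae_fiber_jordan (φ := φ) hΦ, ae_commute_fiber hX] with x h1 h2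
    exact triangular_of_commute h1.1 h1.2.1 h1.2.2 h2
  refine ⟨a ⟨0, hn⟩ ⟨0, hn⟩, a, ?_⟩
  refine congrArg matrixMulOp ?_
  ext1 i j
  rcases lt_trichotomy i j with h | rfl | h
  · simp [triangularSymbol, h]
  · simp only [triangularSymbol, Matrix.of_apply, lt_irrefl, if_false, if_true]
    refine Lp.ext ?_
    filter_upwards [htri] with x hx using hx.2 i ⟨0, hn⟩
  · simp only [triangularSymbol, Matrix.of_apply, h.not_gt, h.ne', if_false]
    refine Lp.ext ?_
    filter_upwards [htri, Lp.coeFn_zero ℂ ∞ μ] with x hx h0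
    exact (hx.1 i j h).trans h0.symm

theorem isFiberwiseZeroOne_of_mem_commutant
    (hΦ : ∀ i j : Fin n, (j : ℕ) = (i : ℕ) + 1 → ∀ᵐ x ∂μ, (Φ i j : Λ → ℂ) x ≠ 0)
    (hφ : ∃ s ∈ ae μ, Set.InjOn (φ : Λ → ℂ) s) {P : L2Pow μ n →L[ℂ] L2Pow μ n}
    (hP : P ∈ commutant (triangularOp φ Φ)) (hid : IsIdempotentElem P) :
    IsFiberwiseZeroOne P := by
  obtain ⟨a, rfl⟩ := exists_eq_matrixMulOp hφ hP
  have ha := isDirectIntegral_matrixMulOp a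
  have hsq : ∀ᵐ x ∂μ, fiber a x * fiber a x = fiber a x := by
    refine (ha.mul ha).ae_eq ?_
    rw [hid.eq]
    exact ha
  refine isFiberwiseZeroOne_of_ae ?_
  filter_upwards [ae_fiber_jordan (φ := φ) hΦ, ae_commute_fiber hP, hsq] with x h1 h2 h3
  exact eq_zero_or_one_of_idempotent_of_commute h1.1 h1.2.1 h1.2.2 h2 h3

/-- The idempotents in `{T}'` are projections and commute with each other, so they form the
largest abelian set of idempotents in `{T}'`. -/
theorem isBoundedMaximalAbelianIdempotentSet_iff
    (hΦ : ∀ i j : Fin n, (j : ℕ) = (i : ℕ) + 1 → ∀ᵐ x ∂μ, (Φ i j : Λ → ℂ) x ≠ 0)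
    (hφ : ∃ s ∈ ae μ, Set.InjOn (φ : Λ → ℂ) s) (𝒬 : Set (L2Pow μ n →L[ℂ] L2Pow μ n)) :
    IsBoundedMaximalAbelianIdempotentSet (triangularOp φ Φ) 𝒬 ↔
      𝒬 = {P | P ∈ commutant (triangularOp φ Φ) ∧ IsStarProjection P} := by
  set 𝒜 : Set (L2Pow μ n →L[ℂ] L2Pow μ n) :=
    {P | P ∈ commutant (triangularOp φ Φ) ∧ IsStarProjection P}
  have hab : IsAbelianIdempotentSet (triangularOp φ Φ) 𝒜 :=
    ⟨fun P hP => hP.1, fun P hP => hP.2.isIdempotentElem, fun P hP Q hQ =>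
      (isFiberwiseZeroOne_of_mem_commutant hΦ hφ hP.1 hP.2.isIdempotentElem).commute
        (isFiberwiseZeroOne_of_mem_commutant hΦ hφ hQ.1 hQ.2.isIdempotentElem)⟩
  have hle : ∀ S, IsAbelianIdempotentSet (triangularOp φ Φ) S → S ⊆ 𝒜 := fun S hS P hP =>
    ⟨hS.1 hP, (isFiberwiseZeroOne_of_mem_commutant hΦ hφ (hS.1 hP) (hS.2.1 P hP)).isStarProjection⟩
  constructor
  · exact fun h => (hle 𝒬 h.1.prop).antisymm (h.1.le_of_ge hab (hle 𝒬 h.1.prop))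
  · rintro rfl
    exact ⟨⟨hab, fun S hS _ => hle S hS⟩, 1, fun P hP => hP.2.norm_le⟩

end Commutant

end JordanSID

theorem lemma3p2 {Λ : Type*} [MeasurableSpace Λ] [StandardBorelSpace Λ]
    (μ : Measure Λ) [SigmaFinite μ] (n : ℕ) (hn : 1 ≤ n)
    (φ : Lp ℂ ∞ μ) (Φ : Fin n → Fin n → Lp ℂ ∞ μ)
    (hΦ : ∀ i j : Fin n, (j : ℕ) = (i : ℕ) + 1 → ∀ᵐ x ∂μ, (Φ i j : Λ → ℂ) x ≠ 0)
    (hφ : ∃ s ∈ ae μ, Set.InjOn (φ : Λ → ℂ) s) :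
    -- `T` is the direct integral of its fibres, which are strongly irreducible a.e.
    JordanSID.IsSID μ (JordanSID.triangularOp φ Φ)
        (JordanSID.fiber (JordanSID.triangularSymbol φ Φ)) ∧
    -- every operator in `{T}'` is of the same triangular form, with a constant diagonal
    (∀ X ∈ JordanSID.commutant (JordanSID.triangularOp φ Φ),
      ∃ (ψ : Lp ℂ ∞ μ) (Ψ : Fin n → Fin n → Lp ℂ ∞ μ), X = JordanSID.triangularOp ψ Ψ) ∧
    -- the projections in `{T}'` form the one and only bounded maximal abelian set of idempotents
    (∀ 𝒬 : Set (JordanSID.L2Pow μ n →L[ℂ] JordanSID.L2Pow μ n),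
      JordanSID.IsBoundedMaximalAbelianIdempotentSet (JordanSID.triangularOp φ Φ) 𝒬 ↔
        𝒬 = {P | P ∈ JordanSID.commutant (JordanSID.triangularOp φ Φ) ∧ IsStarProjection P}) ∧
    JordanSID.SIDUniqueUpToSimilarity (JordanSID.triangularOp φ Φ) := by
  have hiff := JordanSID.isBoundedMaximalAbelianIdempotentSet_iff hΦ hφ
  refine ⟨JordanSID.isSID_triangularOp hΦ,
    fun X hX => JordanSID.exists_eq_triangularOp hn hΦ hφ hX, hiff, fun S S' hS hS' => ?_⟩
  refine ⟨1, fun B hB => ?_, ?_⟩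
  · rw [Units.val_one, mul_one, one_mul]
  · rw [(hiff S).1 hS, (hiff S').1 hS']
    simp
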